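/- Let $p\ge 5$ be a prime, let $G$ be a finite $p$-group, and let $d\ge 0$ be an integer. Let $G^{(d)}$ denote the $d$-th term of the derived series of $G$, defined by $G^{(0)}=G$ and $G^{(i+1)}=[G^{(i)},G^{(i)}]$. If $G^{(d)}\neq 1$, then $$\log_p|G|\ \ge\ 2^d+3d-6.$$ -/

import Mathlib

open scoped commutatorElement

/-! Write γ_n for `lcs G n`. Since G^(i) ≤ γ_{2^i}, P. Hall's bound gives |G^(i)/G^(i+1)| ≥
p^(2^i+1) for i < d. Together with G^(d) ≠ 1 this yields the exponent 2^d + d, so a further 2d - 6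
must be gained.

Let j be the first index with G^(j) ≤ γ_{2^j+1}, or j = d if there is none below d. From j on, the
derived series descends faster: G^(j+s) ≤ γ_{2^s(2^j+1)}, so Hall's bound itself improves by 2^s.

For 0 < i < j - 2 the gain is 2. Filter H = G^(i) by H ∩ γ_n. If H' were cyclic modulo γ_{n+1} in
its lowest degree n = 2^(i+1), then H'' ≤ γ_{2n+1}, against the choice of j. Hence the lowest factor
of H has order at least p^3 (two generators would give one commutator), and a middle factor has
order at least p^2. The latter is `commutator_commutator_le_zpowers_sup`, resting on the multilinear
algebra of `trilinear_eq_one_or_cyclic`, where p ≥ 5 enters. For i = 0 only the first argument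
applies and the gain is 1. -/

/-- The `n`-th term of the lower central series of `G`, indexed so that `lcs G 1 = G`
(and `lcs G 0 = G`). -/
def lcs (G : Type*) [Group G] (n : ℕ) : Subgroup G :=
  (⊤ : Subgroup G).lowerCentralSeries (n - 1)

/-- The iterated commutator `[N, G, …, G]` with `n` entries `G`. -/
def iteratedCommutator {G : Type*} [Group G] (N : Subgroup G) : ℕ → Subgroup G
  | 0 => N
  | n + 1 => ⁅iteratedCommutator N n, ⊤⁆

/-! ### Lower central filtration and its graded commutator -/

section Filtration

variable {G : Type*} [Group G]

instance lcs_normal (n : ℕ) : (lcs G n).Normal := by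
  unfold lcs; infer_instance

theorem lcs_one : lcs G 1 = ⊤ := rfl

theorem lcs_succ {n : ℕ} (hn : 1 ≤ n) : lcs G (n + 1) = ⁅lcs G n, ⊤⁆ := by
  obtain ⟨m, rfl⟩ := Nat.exists_eq_add_of_le' hn
  rfl

theorem lcs_antitone : Antitone (lcs G) := fun _ _ h =>
  (⊤ : Subgroup G).lowerCentralSeries_antitone (Nat.sub_le_sub_right h 1)

instance iteratedCommutator_normal (N : Subgroup G) [hN : N.Normal] (n : ℕ) :
    (iteratedCommutator N n).Normal := by
  induction n with
  | zero => exact hN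
  | succ n ih => exact Subgroup.commutator_normal _ _

theorem iteratedCommutator_succ_le (N : Subgroup G) [N.Normal] (n : ℕ) :
    iteratedCommutator N (n + 1) ≤ iteratedCommutator N n :=
  Subgroup.commutator_le_left _ _

theorem iteratedCommutator_antitone (N : Subgroup G) [N.Normal] :
    Antitone (iteratedCommutator N) :=
  antitone_nat_of_succ_le (iteratedCommutator_succ_le N)

theorem iteratedCommutator_comm (N : Subgroup G) (n : ℕ) :
    iteratedCommutator ⁅N, ⊤⁆ n = iteratedCommutator N (n + 1) := by
  induction n with
  | zero => rfl
  | succ n ih => rw [iteratedCommutator, ih]; rfl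

theorem iteratedCommutator_lcs {a : ℕ} (ha : 1 ≤ a) (n : ℕ) :
    iteratedCommutator (lcs G a) n = lcs G (a + n) := by
  induction n with
  | zero => rfl
  | succ n ih => rw [iteratedCommutator, ih, ← add_assoc, lcs_succ (by omega)]

theorem iteratedCommutator_mono {N K : Subgroup G} (h : N ≤ K) (n : ℕ) :
    iteratedCommutator N n ≤ iteratedCommutator K n := by
  induction n with
  | zero => exact h
  | succ n ih => exact Subgroup.commutator_mono ih le_rfl

theorem iteratedCommutator_add (N : Subgroup G) (m n : ℕ) :
    iteratedCommutator N (m + n) = iteratedCommutator (iteratedCommutator N m) n := by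
  induction n with
  | zero => rfl
  | succ n ih => rw [← add_assoc, iteratedCommutator, ih]; rfl

/-- The three subgroups lemma for normal subgroups. -/
theorem commutator_commutator_le_sup (A B C : Subgroup G) [A.Normal] [B.Normal] [C.Normal] :
    ⁅A, ⁅B, C⁆⁆ ≤ ⁅⁅A, B⁆, C⁆ ⊔ ⁅⁅A, C⁆, B⁆ := by
  set M := ⁅⁅A, B⁆, C⁆ ⊔ ⁅⁅A, C⁆, B⁆ with hM
  have key : ∀ K : Subgroup G, K ≤ M → K.map (QuotientGroup.mk' M) = ⊥ := fun K hK => by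
    rw [Subgroup.map_eq_bot_iff, QuotientGroup.ker_mk']; exact hK
  have h : (⁅⁅B, C⁆, A⁆).map (QuotientGroup.mk' M) = ⊥ := by
    simp only [Subgroup.map_commutator]
    apply Subgroup.commutator_commutator_eq_bot_of_rotate
    · simp only [← Subgroup.map_commutator]
      apply key
      rw [Subgroup.commutator_comm C A]
      exact le_sup_right
    · simp only [← Subgroup.map_commutator]
      exact key _ le_sup_left
  rw [Subgroup.map_eq_bot_iff, QuotientGroup.ker_mk', Subgroup.commutator_comm] at h
  exact h

/-- Three subgroups lemma and induction on `n` for all `N` at once: the term [[N, G], γ_n] needs the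
induction hypothesis for [N, G]. -/
theorem commutator_lcs_le (N : Subgroup G) [N.Normal] (n : ℕ) :
    ⁅N, lcs G n⁆ ≤ iteratedCommutator N n := by
  induction n generalizing N with
  | zero => exact Subgroup.commutator_le_left _ _
  | succ n ih =>
    rcases Nat.eq_zero_or_pos n with rfl | hn
    · exact le_rfl
    · rw [lcs_succ hn]
      refine (commutator_commutator_le_sup _ _ _).trans (sup_le ?_ ?_)
      · exact Subgroup.commutator_mono (ih N) le_rfl
      · exact (ih ⁅N, ⊤⁆).trans (iteratedCommutator_comm N n).le

theorem commutator_lcs_lcs_le {a b : ℕ} : ⁅lcs G a, lcs G b⁆ ≤ lcs G (a + b) := by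
  rcases Nat.eq_zero_or_pos a with rfl | ha
  · rw [zero_add]; exact Subgroup.commutator_le_right _ _
  · exact (commutator_lcs_le _ b).trans (iteratedCommutator_lcs ha b).le

theorem commutatorElement_mem_lcs {a b n : ℕ} {x y : G} (hx : x ∈ lcs G a) (hy : y ∈ lcs G b)
    (hn : n ≤ a + b) : ⁅x, y⁆ ∈ lcs G n :=
  lcs_antitone hn (commutator_lcs_lcs_le (Subgroup.commutator_mem_commutator hx hy))

theorem derivedSeries_le_lcs_add {j c : ℕ} (h : derivedSeries G j ≤ lcs G c) (s : ℕ) :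
    derivedSeries G (j + s) ≤ lcs G (2 ^ s * c) := by
  induction s with
  | zero => simpa using h
  | succ s ih =>
    rw [← add_assoc, derivedSeries_succ, pow_succ]
    refine (Subgroup.commutator_mono ih ih).trans (commutator_lcs_lcs_le.trans (le_of_eq ?_))
    congr 1; ring

theorem derivedSeries_le_lcs (i : ℕ) : derivedSeries G i ≤ lcs G (2 ^ i) := by
  simpa using derivedSeries_le_lcs_add (G := G) (j := 0) (c := 1) le_top i

/-! ### The commutator is bilinear on the graded pieces -/

theorem mk_commutator_mul_left {a b n : ℕ} (ha : 1 ≤ a) (hn : n ≤ a + b + 1) {x x' y : G}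
    (hx : x ∈ lcs G a) (hx' : x' ∈ lcs G a) (hy : y ∈ lcs G b) :
    ((⁅x * x', y⁆ : G) : G ⧸ lcs G n) = ((⁅x, y⁆ : G) : G ⧸ lcs G n) * ((⁅x', y⁆ : G) : G ⧸ lcs G n) := by
  rw [← QuotientGroup.mk_mul, eq_comm, QuotientGroup.eq]
  have e : (⁅x, y⁆ * ⁅x', y⁆)⁻¹ * ⁅x * x', y⁆
      = ⁅x', y⁆⁻¹ * (⁅x, y⁆⁻¹ * ⁅x, ⁅x', y⁆⁆ * ⁅x, y⁆) * ⁅x', y⁆ *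
        ⁅⁅x', y⁆⁻¹, ⁅x, y⁆⁻¹⁆ := by
    simp [commutatorElement_def, mul_assoc]
  have h1 : ⁅x, ⁅x', y⁆⁆ ∈ lcs G n :=
    commutatorElement_mem_lcs hx (commutatorElement_mem_lcs hx' hy le_rfl) (by omega)
  have h2 : ⁅⁅x', y⁆⁻¹, ⁅x, y⁆⁻¹⁆ ∈ lcs G n :=
    commutatorElement_mem_lcs (inv_mem (commutatorElement_mem_lcs hx' hy le_rfl))
      (inv_mem (commutatorElement_mem_lcs hx hy le_rfl)) (by omega)
  rw [e]
  refine mul_mem ?_ h2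
  have := (lcs_normal (G := G) n).conj_mem _ h1 (⁅x, y⁆⁻¹)
  have := (lcs_normal (G := G) n).conj_mem _ this (⁅x', y⁆⁻¹)
  simpa using this

theorem mk_commutator_swap (M : Subgroup G) [M.Normal] (x y : G) :
    ((⁅x, y⁆ : G) : G ⧸ M) = ((⁅y, x⁆ : G) : G ⧸ M)⁻¹ := by
  rw [← QuotientGroup.mk_inv, commutatorElement_inv]

theorem mk_mul_comm_of_mem {a b n : ℕ} (hn : n ≤ a + b) {x y : G}
    (hx : x ∈ lcs G a) (hy : y ∈ lcs G b) :
    (x : G ⧸ lcs G n) * (y : G ⧸ lcs G n) = (y : G ⧸ lcs G n) * (x : G ⧸ lcs G n) := by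
  rw [← commutatorElement_eq_one_iff_mul_comm]
  have := (QuotientGroup.eq_one_iff (N := lcs G n) ⁅x, y⁆).2 (commutatorElement_mem_lcs hx hy hn)
  simpa [commutatorElement_def] using this

theorem mk_commutator_mul_right {a b n : ℕ} (hb : 1 ≤ b) (hn : n ≤ a + b + 1) {x y y' : G}
    (hx : x ∈ lcs G a) (hy : y ∈ lcs G b) (hy' : y' ∈ lcs G b) :
    ((⁅x, y * y'⁆ : G) : G ⧸ lcs G n) = ((⁅x, y⁆ : G) : G ⧸ lcs G n) * ((⁅x, y'⁆ : G) : G ⧸ lcs G n) := by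
  rw [mk_commutator_swap, mk_commutator_mul_left hb (by omega) hy hy' hx, mul_inv_rev,
    ← mk_commutator_swap, ← mk_commutator_swap]
  exact mk_mul_comm_of_mem (a := a + b) (b := a + b) (by omega)
    (commutatorElement_mem_lcs hx hy' le_rfl) (commutatorElement_mem_lcs hx hy le_rfl)

theorem mk_commutator_congr_left {a b n : ℕ} (ha : 1 ≤ a) (hn : n ≤ a + b + 1) {x x' y : G}
    (hx : x ∈ lcs G a) (hy : y ∈ lcs G b)
    (h : (x : G ⧸ lcs G (a + 1)) = (x' : G ⧸ lcs G (a + 1))) :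
    ((⁅x, y⁆ : G) : G ⧸ lcs G n) = ((⁅x', y⁆ : G) : G ⧸ lcs G n) := by
  rw [QuotientGroup.eq] at h
  have e : x' = x * (x⁻¹ * x') := by group
  rw [e, mk_commutator_mul_left ha hn hx (lcs_antitone (Nat.le_succ a) h) hy,
    (QuotientGroup.eq_one_iff _).2 (commutatorElement_mem_lcs h hy (by omega)), mul_one]

theorem mk_commutator_congr_right {a b n : ℕ} (hb : 1 ≤ b) (hn : n ≤ a + b + 1) {x y y' : G}
    (hx : x ∈ lcs G a) (hy : y ∈ lcs G b)
    (h : (y : G ⧸ lcs G (b + 1)) = (y' : G ⧸ lcs G (b + 1))) :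
    ((⁅x, y⁆ : G) : G ⧸ lcs G n) = ((⁅x, y'⁆ : G) : G ⧸ lcs G n) := by
  rw [mk_commutator_swap, mk_commutator_congr_left hb (by omega) hy hx h, ← mk_commutator_swap]

theorem mk_conj_eq {b : ℕ} {x y : G} (hy : y ∈ lcs G b) :
    ((x * y * x⁻¹ : G) : G ⧸ lcs G (b + 1)) = (y : G ⧸ lcs G (b + 1)) := by
  have := mk_mul_comm_of_mem (n := b + 1) (a := 1) (b := b) (by omega) (x := x) trivial hy
  rw [QuotientGroup.mk_mul, QuotientGroup.mk_mul, this, QuotientGroup.mk_inv, mul_inv_cancel_right]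

/-- The Jacobi identity on the graded pieces of the lower central series. -/
theorem mk_jacobi {a b c n : ℕ} (ha : 1 ≤ a) (hb : 1 ≤ b) (hc : 1 ≤ c) (hn : n ≤ a + b + c + 1)
    {x y z : G} (hx : x ∈ lcs G a) (hy : y ∈ lcs G b) (hz : z ∈ lcs G c) :
    ((⁅⁅x, y⁆, z⁆ : G) : G ⧸ lcs G n) * ((⁅⁅y, z⁆, x⁆ : G) : G ⧸ lcs G n) *
      ((⁅⁅z, x⁆, y⁆ : G) : G ⧸ lcs G n) = 1 := by
  -- Hall–Witt identity; its conjugations are invisible modulo γ_n.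
  have h := congrArg (QuotientGroup.mk : G → G ⧸ lcs G n)
    (commutatorElement_commutatorElement_conj_mul x y z)
  rw [QuotientGroup.mk_mul, QuotientGroup.mk_mul,
    mk_commutator_congr_right (a := a + b) hc (by omega) (commutatorElement_mem_lcs hx hy le_rfl)
      ((lcs_normal c).conj_mem _ hz _) (mk_conj_eq hz),
    mk_commutator_congr_right (a := b + c) ha (by omega) (commutatorElement_mem_lcs hy hz le_rfl)
      ((lcs_normal a).conj_mem _ hx _) (mk_conj_eq hx),
    mk_commutator_congr_right (a := c + a) hb (by omega) (commutatorElement_mem_lcs hz hx le_rfl)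
      ((lcs_normal b).conj_mem _ hy _) (mk_conj_eq hy)] at h
  exact h

theorem mk_commutator_commutator {a b c n : ℕ} (ha : 1 ≤ a) (hb : 1 ≤ b) (hc : 1 ≤ c)
    (hn : n ≤ a + b + c + 1) {x u v : G} (hx : x ∈ lcs G a) (hu : u ∈ lcs G b) (hv : v ∈ lcs G c) :
    ((⁅x, ⁅u, v⁆⁆ : G) : G ⧸ lcs G n) =
      ((⁅⁅x, v⁆, u⁆ : G) : G ⧸ lcs G n)⁻¹ * ((⁅⁅x, u⁆, v⁆ : G) : G ⧸ lcs G n) := by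
  have h := mk_jacobi ha hb hc hn hx hu hv
  have e : ((⁅⁅v, x⁆, u⁆ : G) : G ⧸ lcs G n) = ((⁅⁅x, v⁆, u⁆ : G) : G ⧸ lcs G n)⁻¹ := by
    have := mk_commutator_mul_left (a := a + c) (b := b) (n := n) (by omega) (by omega)
      (commutatorElement_mem_lcs hv hx (by omega)) (commutatorElement_mem_lcs hx hv le_rfl) hu
    rw [← commutatorElement_inv x v, inv_mul_cancel, commutatorElement_one_left,
      QuotientGroup.mk_one] at this
    rw [← commutatorElement_inv x v]
    exact (inv_eq_of_mul_eq_one_left this.symm).symm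
  rw [mk_commutator_swap, ← e]
  rw [mul_assoc] at h
  exact inv_eq_of_mul_eq_one_right (by rw [← mul_assoc]; exact mul_eq_one_comm.1 h)

/-- Membership of commutators in a subgroup can be checked on generators, modulo deeper terms of the
lower central series. -/
theorem commutator_closure_le {a b : ℕ} (ha : 1 ≤ a) (hb : 1 ≤ b) {T U : Set G} {S : Subgroup G}
    (hT : T ⊆ lcs G a) (hU : U ⊆ lcs G b) (hS : lcs G (a + b + 1) ≤ S)
    (h : ∀ t ∈ T, ∀ u ∈ U, ⁅t, u⁆ ∈ S) : ⁅Subgroup.closure T, Subgroup.closure U⁆ ≤ S := by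
  have trans : ∀ x y : G, (x : G ⧸ lcs G (a + b + 1)) = y → y ∈ S → x ∈ S := fun x y hxy hy => by
    rw [QuotientGroup.eq] at hxy
    have := mul_mem hy (inv_mem (hS hxy))
    simpa using this
  have hT' : Subgroup.closure T ≤ lcs G a := (Subgroup.closure_le _).2 hT
  have hU' : Subgroup.closure U ≤ lcs G b := (Subgroup.closure_le _).2 hU
  have left : ∀ t ∈ T, ∀ y ∈ Subgroup.closure U, ⁅t, y⁆ ∈ S := by
    intro t ht y hy
    induction hy using Subgroup.closure_induction with
    | mem y hy => exact h t ht y hy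
    | one => simp
    | mul y z hy hz ihy ihz =>
      refine trans _ (⁅t, y⁆ * ⁅t, z⁆) ?_ (mul_mem ihy ihz)
      exact mk_commutator_mul_right hb le_rfl (hT ht) (hU' hy) (hU' hz)
    | inv y hy ih =>
      refine trans _ (⁅t, y⁆⁻¹) ?_ (inv_mem ih)
      have := mk_commutator_mul_right (n := a + b + 1) hb le_rfl (hT ht) (hU' hy) (inv_mem (hU' hy))
      rw [mul_inv_cancel, commutatorElement_one_right, QuotientGroup.mk_one] at this
      rw [QuotientGroup.mk_inv]
      exact eq_inv_of_mul_eq_one_right this.symm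
  rw [Subgroup.commutator_le]
  intro x hx y hy
  induction hx using Subgroup.closure_induction with
  | mem x hx => exact left x hx y hy
  | one => simp
  | mul x z hx hz ihx ihz =>
    refine trans _ (⁅x, y⁆ * ⁅z, y⁆) ?_ (mul_mem ihx ihz)
    exact mk_commutator_mul_left ha le_rfl (hT' hx) (hT' hz) (hU' hy)
  | inv x hx ih =>
    refine trans _ (⁅x, y⁆⁻¹) ?_ (inv_mem ih)
    have := mk_commutator_mul_left (n := a + b + 1) ha le_rfl (hT' hx) (inv_mem (hT' hx)) (hU' hy)
    rw [mul_inv_cancel, commutatorElement_one_left, QuotientGroup.mk_one] at this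
    rw [QuotientGroup.mk_inv]
    exact eq_inv_of_mul_eq_one_right this.symm

/-- The only possible contribution in degree 2n is ⁅z, z⁆ = 1. This turns "cyclic in lowest degree"
into a drop of the next derived term. -/
theorem commutator_self_le_of_le_zpowers_sup {K : Subgroup G} {z : G} {n : ℕ} (hn : 1 ≤ n)
    (hz : z ∈ lcs G n) (hK : K ≤ Subgroup.zpowers z ⊔ lcs G (n + 1)) :
    ⁅K, K⁆ ≤ lcs G (2 * n + 1) := by
  have hT : insert z (lcs G (n + 1) : Set G) ⊆ lcs G n :=
    Set.insert_subset hz (lcs_antitone (Nat.le_succ n))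
  have hK' : K ≤ Subgroup.closure (insert z (lcs G (n + 1) : Set G)) := by
    refine hK.trans (sup_le ?_ ?_)
    · rw [Subgroup.zpowers_le]; exact Subgroup.subset_closure (Set.mem_insert _ _)
    · exact fun x hx => Subgroup.subset_closure (Set.mem_insert_of_mem _ hx)
  refine (Subgroup.commutator_mono hK' hK').trans
    (commutator_closure_le hn hn hT hT (lcs_antitone (by omega)) ?_)
  rintro t (rfl | ht) u (rfl | hu)
  · simp
  · exact commutatorElement_mem_lcs hz hu (by omega)
  · exact commutatorElement_mem_lcs ht hz (by omega)
  · exact commutatorElement_mem_lcs ht hu (by omega)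

end Filtration

/-! ### Multilinear algebra over a group of prime order -/

section Trilinear

/-- Let `F` be a trilinear map to a group `C` of prime order `p ≥ 5` that is alternating in the
first two arguments and satisfies the Jacobi identity, and let `h` be bilinear on `C × A`.
If `h (F u v u) v = h (F u v v) u` for all `u, v`, then `F` is trivial or all values of `h` lie in
one cyclic subgroup. -/
theorem trilinear_eq_one_or_cyclic {p : ℕ} (hp : p.Prime) (hp5 : 5 ≤ p) {A C V : Type*} [Group A]
    [CommGroup C] [Group V] (hC : Nat.card C = p) (F : A → A → A → C) (h : C → A → V)
    (F1 : ∀ u u' v w, F (u * u') v w = F u v w * F u' v w)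
    (F2 : ∀ u v v' w, F u (v * v') w = F u v w * F u v' w)
    (F3 : ∀ u v w w', F u v (w * w') = F u v w * F u v w')
    (Falt : ∀ u w, F u u w = 1)
    (Fjac : ∀ u v w, F u v w * F v w u * F w u v = 1)
    (h1 : ∀ c c' a, h (c * c') a = h c a * h c' a)
    (h2 : ∀ c a a', h c (a * a') = h c a * h c a')
    (hF : ∀ u v, h (F u v u) v = h (F u v v) u) :
    (∀ u v w, F u v w = 1) ∨ ∃ c₀ u₀, ∀ c a, h c a ∈ Subgroup.zpowers (h c₀ u₀) := by
  have hgen : ∀ c : C, c ≠ 1 → ∀ x, ∃ n : ℤ, c ^ n = x := fun c hc x => by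
    have := Fact.mk hp
    exact Subgroup.mem_zpowers_iff.1 (mem_zpowers_of_prime_card hC hc)
  have hpow : ∀ k : ℕ, 1 < k → k < 5 → ∀ c : C, c ^ k = 1 → c = 1 := by
    intro k hk1 hk c hc
    have h1 : orderOf c ∣ k := orderOf_dvd_of_pow_eq_one hc
    have h2 : orderOf c ∣ p := hC ▸ orderOf_dvd_natCard c
    rcases (Nat.dvd_prime hp).1 h2 with h3 | h3
    · exact orderOf_eq_one_iff.1 h3
    · have := Nat.le_of_dvd (by omega) h1; omega
  let hh : A → C →* V := fun a => MonoidHom.mk' (fun c => h c a) (fun c c' => h1 c c' a)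
  by_cases hcyc : ∃ u₀, ∀ a c, h c a ∈ (hh u₀).range
  · right
    obtain ⟨u₀, hu₀⟩ := hcyc
    have : Finite C := Nat.finite_of_card_ne_zero (hC ▸ hp.ne_zero)
    have : Nontrivial C := Finite.one_lt_card_iff_nontrivial.1 (hC ▸ hp.one_lt)
    obtain ⟨c₀, hc₀⟩ := exists_ne (1 : C)
    refine ⟨c₀, u₀, fun c a => ?_⟩
    obtain ⟨x, hx⟩ := hu₀ a c
    obtain ⟨n, rfl⟩ := hgen c₀ hc₀ x
    rw [← hx, map_zpow]
    exact Subgroup.zpow_mem_zpowers _ _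
  · left
    push Not at hcyc
    -- A nontrivial `F u v u` generates C, and `hF` then pushes all of h(C, v) into h(C, u).
    have step1 : ∀ u v c, (∃ c', h c' u ≠ 1) → h c v ∉ (hh u).range → F u v u = 1 := by
      intro u v c ⟨c', hc'⟩ hv
      by_contra hne
      obtain ⟨n, rfl⟩ := hgen _ hne c
      apply hv
      have : h (F u v u ^ n) v = hh u (F u v v ^ n) := by
        have h3 : hh v (F u v u ^ n) = hh u (F u v v ^ n) := by
          rw [map_zpow, map_zpow]; congr 1; exact hF u v
        exact h3
      rw [this]; exact ⟨_, rfl⟩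
    -- If `v` itself is not outside h(C, u), both `b` and `v * b` are; linearity in the second
    -- argument recovers `v`.
    have step2 : ∀ u v, (∃ c', h c' u ≠ 1) → F u v u = 1 := by
      intro u v hu
      obtain ⟨b, c, hb⟩ := hcyc u
      by_cases hv : h c v ∈ (hh u).range
      · have hvb : h c (v * b) ∉ (hh u).range := by
          rw [h2]; exact fun hm => hb (((hh u).range.mul_mem_cancel_left hv).1 hm)
        have e := step1 u (v * b) c hu hvb
        rwa [F2, step1 u b c hu hb, mul_one] at e
      · exact step1 u v c hu hv
    have F_inv1 : ∀ u v w, F u⁻¹ v w = (F u v w)⁻¹ := fun u v w => by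
      have := F1 1 1 v w
      rw [mul_one, left_eq_mul] at this
      rw [eq_inv_iff_mul_eq_one, ← F1, inv_mul_cancel, this]
    have F_inv3 : ∀ u v w, F u v w⁻¹ = (F u v w)⁻¹ := fun u v w => by
      have := F3 u v 1 1
      rw [mul_one, left_eq_mul] at this
      rw [eq_inv_iff_mul_eq_one, ← F3, inv_mul_cancel, this]
    -- If h(·, u) is trivial, `step2` applies to `u * a` and `u * a⁻¹`; multiplying the two
    -- expansions cancels the cross terms and leaves `F u v u ^ 2 = 1`.
    have step3 : ∀ u v, F u v u = 1 := by
      intro u v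
      by_cases hu : ∃ c', h c' u ≠ 1
      · exact step2 u v hu
      · push Not at hu
        obtain ⟨a, c, ha⟩ := hcyc u
        have ha1 : h c a ≠ 1 := fun e => ha (e ▸ one_mem _)
        have hinv : h c a⁻¹ ≠ 1 := fun e => ha1 (by
          have h3 := h2 c a a⁻¹
          have h4 := h2 c 1 1
          rw [mul_one, left_eq_mul] at h4
          rw [mul_inv_cancel, h4, e, mul_one] at h3
          exact h3.symm)
        have e1 := step2 (u * a) v ⟨c, by rw [h2, hu, one_mul]; exact ha1⟩
        have e2 := step2 (u * a⁻¹) v ⟨c, by rw [h2, hu, one_mul]; exact hinv⟩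
        have e3 := step2 a v ⟨c, ha1⟩
        rw [F1, F3, F3, e3, mul_one] at e1
        rw [F1, F3, F3, F_inv1, F_inv1, F_inv3, F_inv3, e3, inv_one, inv_one, mul_one] at e2
        apply hpow 2 (by norm_num) (by norm_num)
        calc F u v u ^ 2 = (F u v u * F u v a * F a v u) *
              (F u v u * (F u v a)⁻¹ * (F a v u)⁻¹) := by
                rw [pow_two, mul_mul_mul_comm, mul_inv_cancel, mul_one, mul_mul_mul_comm,
                  mul_inv_cancel, mul_one]
          _ = 1 := by rw [e1, e2, mul_one]
    intro u v w
    have s12 : ∀ u v w, F u v w = (F v u w)⁻¹ := fun u v w => by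
      have := Falt (u * v) w
      rw [F1, F2, F2, Falt, Falt, one_mul, mul_one] at this
      exact eq_inv_of_mul_eq_one_left this
    have s13 : ∀ u v w, F u v w = (F w v u)⁻¹ := fun u v w => by
      have := step3 (u * w) v
      rw [F1, F3, F3, step3, step3, one_mul, mul_one] at this
      exact eq_inv_of_mul_eq_one_left this
    have cyc : ∀ u v w, F v w u = F u v w := fun u v w => by
      rw [s12 v w u, s13 w v u, inv_inv]
    -- `F` is now invariant under cyclic shifts, so the Jacobi identity says that its cube is
    -- trivial.
    apply hpow 3 (by norm_num) (by norm_num)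
    have := Fjac u v w
    rw [cyc u v w, ← cyc w u v] at this
    rw [pow_succ, pow_two]
    exact this

end Trilinear

/-! ### Sections of order at most p^2 -/

section TwoGenerated

/-- An abelian group of order dividing `p ^ 2` is generated by two elements. -/
theorem exists_closure_pair_eq_top {p : ℕ} (hp : p.Prime) {X : Type*} [Group X]
    (hX : Nat.card X ∣ p ^ 2) : ∃ x y : X, Subgroup.closure {x, y} = ⊤ := by
  have : Finite X := Nat.finite_of_card_ne_zero fun h => by
    rw [h, zero_dvd_iff] at hX; exact (pow_ne_zero 2 hp.ne_zero) hX
  have hcard : ∀ H : Subgroup X, Nat.card H ∣ p ^ 2 := fun H => 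
    (Subgroup.card_subgroup_dvd_card H).trans hX
  have hlt : ∀ H K : Subgroup X, H < K → Nat.card H < Nat.card K := fun H K h =>
    lt_of_le_of_ne (Nat.le_of_dvd Nat.card_pos (Subgroup.card_dvd_of_le h.le))
      fun e => h.ne (Subgroup.eq_of_le_of_card_ge h.le e.ge)
  by_contra! hne
  obtain ⟨x, hx⟩ : ∃ x : X, x ≠ 1 := by
    by_contra! h1
    exact hne 1 1 (by rw [eq_top_iff]; intro g _; rw [h1 g]; exact one_mem _)
  have hxt : Subgroup.zpowers x < ⊤ := lt_top_iff_ne_top.2 fun h =>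
    hne x x (by rw [Set.pair_eq_singleton, ← Subgroup.zpowers_eq_closure, h])
  obtain ⟨y, -, hy⟩ := SetLike.exists_of_lt hxt
  have hxy : Subgroup.zpowers x < Subgroup.closure {x, y} := by
    refine lt_of_le_of_ne ?_ fun h => hy (h ▸ Subgroup.subset_closure (by simp))
    rw [Subgroup.zpowers_le]; exact Subgroup.subset_closure (by simp)
  have hbot : (⊥ : Subgroup X) < Subgroup.zpowers x := by
    rw [bot_lt_iff_ne_bot, Ne, Subgroup.zpowers_eq_bot]; exact hx
  -- The chain 1 < ⟨x⟩ < ⟨x, y⟩ < X would need four distinct orders among 1, p, p^2.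
  have l1 := hlt _ _ hbot
  have l2 := hlt _ _ hxy
  have l3 := hlt _ _ (lt_top_iff_ne_top.2 (hne x y))
  obtain ⟨a, ha, ea⟩ := (Nat.dvd_prime_pow hp).1 (hcard ⊥)
  obtain ⟨b, hb, eb⟩ := (Nat.dvd_prime_pow hp).1 (hcard (Subgroup.zpowers x))
  obtain ⟨c, hc, ec⟩ := (Nat.dvd_prime_pow hp).1 (hcard (Subgroup.closure {x, y}))
  obtain ⟨d, hd, ed⟩ := (Nat.dvd_prime_pow hp).1 (hcard ⊤)
  rw [ea, eb, Nat.pow_lt_pow_iff_right hp.one_lt] at l1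
  rw [eb, ec, Nat.pow_lt_pow_iff_right hp.one_lt] at l2
  rw [ec, ed, Nat.pow_lt_pow_iff_right hp.one_lt] at l3
  omega

variable {G : Type*} [Group G]

/-- Modulo γ_{k+1}, H has two generators x, y; by bilinearity ⁅x, y⁆ alone generates H' modulo
γ_{2k+1}. -/
theorem commutator_le_zpowers_sup_of_relIndex_dvd {p : ℕ} (hp : p.Prime) {k : ℕ} (hk : 1 ≤ k)
    {H : Subgroup G} (hH : H ≤ lcs G k) (hi : (lcs G (k + 1)).relIndex H ∣ p ^ 2) :
    ∃ z ∈ lcs G (2 * k), ⁅H, H⁆ ≤ Subgroup.zpowers z ⊔ lcs G (2 * k + 1) := by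
  have hi' : Nat.card (H.map (QuotientGroup.mk' (lcs G (k + 1)))) ∣ p ^ 2 := by
    rwa [← Subgroup.relIndex_ker, QuotientGroup.ker_mk']
  obtain ⟨⟨_, x, hx, rfl⟩, ⟨_, y, hy, rfl⟩, hxy⟩ := exists_closure_pair_eq_top hp hi'
  set T : Set G := {x, y} ∪ lcs G (k + 1) with hT
  have hHT : H ≤ Subgroup.closure T := by
    have h1 : H.map (QuotientGroup.mk' (lcs G (k + 1))) ≤
        (Subgroup.closure {x, y}).map (QuotientGroup.mk' (lcs G (k + 1))) := by
      have := congrArg (Subgroup.map (Subgroup.subtype _)) hxy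
      rw [MonoidHom.map_closure, ← MonoidHom.range_eq_map, Subgroup.range_subtype,
        Set.image_pair] at this
      rw [MonoidHom.map_closure, Set.image_pair, ← this]
      exact le_rfl
    have h2 := Subgroup.map_le_iff_le_comap.1 h1
    rw [Subgroup.comap_map_eq, QuotientGroup.ker_mk'] at h2
    rw [hT, Subgroup.closure_union, Subgroup.closure_eq]
    exact h2
  have hTk : T ⊆ lcs G k := by
    rintro t ((rfl | rfl) | ht)
    · exact hH hx
    · exact hH hy
    · exact lcs_antitone (Nat.le_succ k) ht
  have hzS : ⁅x, y⁆ ∈ Subgroup.zpowers ⁅x, y⁆ ⊔ lcs G (2 * k + 1) :=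
    Subgroup.mem_sup_left (Subgroup.mem_zpowers _)
  refine ⟨⁅x, y⁆, commutatorElement_mem_lcs (hH hx) (hH hy) (by omega),
    (Subgroup.commutator_mono hHT hHT).trans
    (commutator_closure_le hk hk hTk hTk ((lcs_antitone (by omega)).trans le_sup_right) ?_)⟩
  have deep : ∀ t u, t ∈ T → u ∈ T → t ∈ lcs G (k + 1) ∨ u ∈ lcs G (k + 1) →
      ⁅t, u⁆ ∈ Subgroup.zpowers ⁅x, y⁆ ⊔ lcs G (2 * k + 1) := fun t u ht hu h => by
    rcases h with h | h
    · exact Subgroup.mem_sup_right (commutatorElement_mem_lcs h (hTk hu) (by omega))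
    · exact Subgroup.mem_sup_right (commutatorElement_mem_lcs (hTk ht) h (by omega))
  intro t ht u hu
  rcases id ht with (rfl | rfl) | h
  · rcases id hu with (rfl | rfl) | h'
    · simp
    · exact hzS
    · exact deep _ _ ht hu (.inr h')
  · rcases id hu with (rfl | rfl) | h'
    · rw [← commutatorElement_inv t u] at hzS; simpa using inv_mem hzS
    · simp
    · exact deep _ _ ht hu (.inr h')
  · exact deep _ _ ht hu (.inl h)

end TwoGenerated

/-! ### A middle section of order p -/

section Cyclic

variable {G : Type*} [Group G]

/-- If `J` lies in `lcs G m` and `H = [J, J]` has a section of prime order `p ≥ 5` in degree `3 * m`,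
then `[H, H]` is cyclic in degree `4 * m`. -/
theorem commutator_commutator_le_zpowers_sup {p : ℕ} (hp : p.Prime) (hp5 : 5 ≤ p) {m : ℕ}
    (hm : 1 ≤ m) {J : Subgroup G} [J.Normal] (hJ : J ≤ lcs G m)
    (hi : (lcs G (3 * m + 1)).relIndex (⁅J, J⁆ ⊓ lcs G (3 * m)) = p) :
    ∃ z ∈ lcs G (4 * m), ⁅⁅J, J⁆, ⁅J, J⁆⁆ ≤ Subgroup.zpowers z ⊔ lcs G (4 * m + 1) := by
  set N := ⁅J, J⁆ ⊓ lcs G (3 * m) with hN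
  let π := QuotientGroup.mk' (lcs G (3 * m + 1))
  let C := N.map π
  have hC : Nat.card C = p := by
    rw [← hi, ← Subgroup.relIndex_ker, QuotientGroup.ker_mk']
  have hCcomm : ∀ a b : C, a * b = b * a := by
    have := Fact.mk hp
    have := isCyclic_of_prime_card hC
    exact fun a b => (IsCyclic.commGroup (α := C)).mul_comm a b
  let : CommGroup C := { (inferInstance : Group C) with mul_comm := hCcomm }
  have hJm : ∀ u : J, (u : G) ∈ lcs G m := fun u => hJ u.2
  have hcm : ∀ u v : J, ⁅(u : G), (v : G)⁆ ∈ lcs G (2 * m) := fun u v =>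
    commutatorElement_mem_lcs (hJm u) (hJm v) (by omega)
  have hcH : ∀ u v : J, ⁅(u : G), (v : G)⁆ ∈ ⁅J, J⁆ := fun u v =>
    Subgroup.commutator_mem_commutator u.2 v.2
  have hFN : ∀ u v w : J, ⁅⁅(u : G), (v : G)⁆, (w : G)⁆ ∈ N := fun u v w =>
    ⟨Subgroup.commutator_le_left _ J (Subgroup.commutator_mem_commutator (hcH u v) w.2),
      commutatorElement_mem_lcs (hcm u v) (hJm w) (by omega)⟩
  let F : J → J → J → C := fun u v w =>
    ⟨π ⁅⁅(u : G), (v : G)⁆, (w : G)⁆, Subgroup.mem_map_of_mem _ (hFN u v w)⟩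
  have lift : ∀ c : C, ∃ x ∈ N, π x = c := fun c => c.2
  choose s hsN hs using lift
  have hs3 : ∀ c, s c ∈ lcs G (3 * m) := fun c => (hsN c).2
  let h : C → J → G ⧸ lcs G (4 * m + 1) := fun c a => ((⁅s c, (a : G)⁆ : G) : G ⧸ lcs G (4 * m + 1))
  -- `h` is independent of the lift: changing it within γ_{3m+1} changes the commutator only within
  -- γ_{4m+1}.
  have hh : ∀ (c : C) (x : G) (a : J), π x = c → h c a = ((⁅x, (a : G)⁆ : G) : G ⧸ lcs G (4 * m + 1)) :=
    fun c x a hx => mk_commutator_congr_left (a := 3 * m) (b := m) (by omega) (by omega) (hs3 c)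
      (hJm a) ((hs c).trans hx.symm)
  have key := trilinear_eq_one_or_cyclic hp hp5 hC F h
    (fun u u' v w => Subtype.ext <| by
      have e := mk_commutator_mul_left (n := 2 * m + 1) hm (by omega) (hJm u) (hJm u') (hJm v)
      exact (mk_commutator_congr_left (a := 2 * m) (b := m) (by omega) (by omega)
        (hcm (u * u') v) (hJm w) e).trans
        (mk_commutator_mul_left (by omega) (by omega) (hcm u v) (hcm u' v) (hJm w)))
    (fun u v v' w => Subtype.ext <| by
      have e := mk_commutator_mul_right (n := 2 * m + 1) hm (by omega) (hJm u) (hJm v) (hJm v')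
      exact (mk_commutator_congr_left (a := 2 * m) (b := m) (by omega) (by omega)
        (hcm u (v * v')) (hJm w) e).trans
        (mk_commutator_mul_left (by omega) (by omega) (hcm u v) (hcm u v') (hJm w)))
    (fun u v w w' => Subtype.ext <|
      mk_commutator_mul_right hm (by omega) (hcm u v) (hJm w) (hJm w'))
    (fun u w => Subtype.ext <| by simp [F])
    (fun u v w => Subtype.ext <| mk_jacobi hm hm hm (by omega) (hJm u) (hJm v) (hJm w))
    (fun c c' a => by
      rw [hh (c * c') (s c * s c') a (by rw [map_mul, hs, hs]; rfl)]
      exact mk_commutator_mul_left (by omega) (by omega) (hs3 c) (hs3 c') (hJm a))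
    (fun c a a' => mk_commutator_mul_right hm (by omega) (hs3 c) (hJm a) (hJm a'))
    (fun u v => by
      rw [hh _ _ v (rfl : π ⁅⁅(u : G), (v : G)⁆, (u : G)⁆ = F u v u),
        hh _ _ u (rfl : π ⁅⁅(u : G), (v : G)⁆, (v : G)⁆ = F u v v)]
      -- Expanding ⁅⁅u, v⁆, ⁅u, v⁆⁆ = 1 by Jacobi gives the symmetry required of `h` and `F`.
      have := mk_commutator_commutator (n := 4 * m + 1) (a := 2 * m) (by omega) hm hm (by omega)
        (hcm u v) (hJm u) (hJm v)
      rw [commutatorElement_self, QuotientGroup.mk_one] at this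
      exact (inv_mul_eq_one.1 this.symm).symm)
  obtain ⟨z, hz, hzh⟩ : ∃ z ∈ lcs G (4 * m), ∀ u v w t : J,
      h (F u v w) t ∈ Subgroup.zpowers (z : G ⧸ lcs G (4 * m + 1)) := by
    rcases key with key | ⟨c, a, key⟩
    · refine ⟨1, one_mem _, fun u v w t => ?_⟩
      rw [key, hh 1 1 t (map_one _), commutatorElement_one_left]
      exact one_mem _
    · exact ⟨⁅s c, (a : G)⁆, commutatorElement_mem_lcs (hs3 c) (hJm a) (by omega),
        fun u v w t => key _ _⟩
  refine ⟨z, hz, ?_⟩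
  set T : Set G := {g | ∃ u ∈ J, ∃ v ∈ J, ⁅u, v⁆ = g} with hT
  have hTm : T ⊆ lcs G (2 * m) := by
    rintro _ ⟨u, hu, v, hv, rfl⟩; exact hcm ⟨u, hu⟩ ⟨v, hv⟩
  rw [Subgroup.commutator_def J J]
  refine commutator_closure_le (by omega) (by omega) hTm hTm
    ((lcs_antitone (by omega)).trans le_sup_right) ?_
  rintro _ ⟨u, hu, v, hv, rfl⟩ _ ⟨u', hu', v', hv', rfl⟩
  -- The same expansion writes each generator of [H, H] in degree 4m through values of `h` on the
  -- image of `F`.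
  have e := mk_commutator_commutator (n := 4 * m + 1) (a := 2 * m) (by omega) hm hm (by omega)
    (hcm ⟨u, hu⟩ ⟨v, hv⟩) (hJm ⟨u', hu'⟩) (hJm ⟨v', hv'⟩)
  have e1 := hzh ⟨u, hu⟩ ⟨v, hv⟩ ⟨v', hv'⟩ ⟨u', hu'⟩
  have e2 := hzh ⟨u, hu⟩ ⟨v, hv⟩ ⟨u', hu'⟩ ⟨v', hv'⟩
  rw [hh _ _ _ rfl] at e1 e2
  have e3 := mul_mem (inv_mem e1) e2
  rw [← e] at e3
  have e4 : ⁅⁅u, v⁆, ⁅u', v'⁆⁆ ∈ ((Subgroup.zpowers z).map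
      (QuotientGroup.mk' (lcs G (4 * m + 1)))).comap (QuotientGroup.mk' (lcs G (4 * m + 1))) := by
    rw [MonoidHom.map_zpowers]; exact e3
  rwa [Subgroup.comap_map_eq, QuotientGroup.ker_mk'] at e4

end Cyclic

/-! ### Lower bounds for the index of the commutator subgroup -/

section Index

variable {G : Type*} [Group G]

theorem relIndex_eq_prod {f : ℕ → Subgroup G} (hf : Antitone f) (n : ℕ) :
    (f n).relIndex (f 0) = ∏ j ∈ Finset.range n, (f (j + 1)).relIndex (f j) := by
  induction n with
  | zero => simp
  | succ n ih =>
    rw [Finset.prod_range_succ, ← ih, mul_comm]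
    exact (Subgroup.relIndex_mul_relIndex _ _ _ (hf (Nat.le_succ n)) (hf (Nat.zero_le n))).symm

theorem iteratedCommutator_not_le [Group.IsNilpotent G] {N : Subgroup G} {j : ℕ}
    (h : iteratedCommutator N j ≠ ⊥) :
    ¬ iteratedCommutator N j ≤ iteratedCommutator N (j + 1) := by
  intro hle
  obtain ⟨n, hn⟩ := Subgroup.nilpotent_iff_lowerCentralSeries.1 ‹Group.IsNilpotent G›
  have hstep : ∀ m, iteratedCommutator N j ≤ (⊤ : Subgroup G).lowerCentralSeries m := by
    intro m
    induction m with
    | zero => exact le_top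
    | succ m ih => exact hle.trans (Subgroup.commutator_mono ih le_rfl)
  exact h (le_bot_iff.1 (hn ▸ hstep n))

/-- Modulo M, N is generated by the central subgroup D and one further element, hence is abelian. -/
theorem commutator_le_of_relIndex_prime {p : ℕ} (hp : p.Prime) {N D M : Subgroup G} [M.Normal]
    (hDN : D ≤ N) (hi : D.relIndex N = p) (hM : ⁅D, N⁆ ≤ M) : ⁅N, N⁆ ≤ M := by
  obtain ⟨x, hx, hxD⟩ : ∃ x ∈ N, x ∉ D := by
    by_contra! h
    exact hp.one_lt.ne' (hi ▸ Subgroup.relIndex_eq_one.2 h)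
  have hle : Subgroup.zpowers x ⊔ D ≤ N := sup_le (by rwa [Subgroup.zpowers_le]) hDN
  have hN : N = Subgroup.zpowers x ⊔ D := by
    refine le_antisymm (Subgroup.relIndex_eq_one.1 ?_) hle
    have hm := Subgroup.relIndex_mul_relIndex D _ N le_sup_right hle
    rw [hi] at hm
    rcases (Nat.dvd_prime hp).1 (Dvd.intro _ hm) with h | h
    · exact (hxD ((Subgroup.relIndex_eq_one.1 h)
        (Subgroup.mem_sup_left (Subgroup.mem_zpowers x)))).elim
    · rw [h] at hm
      exact Nat.eq_of_mul_eq_mul_left hp.pos (hm.trans (mul_one p).symm)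
  set π := QuotientGroup.mk' M
  have h1 : D.map π ≤ Subgroup.centralizer (N.map π : Set (G ⧸ M)) := by
    rw [← Subgroup.commutator_eq_bot_iff_le_centralizer, ← Subgroup.map_commutator,
      Subgroup.map_eq_bot_iff, QuotientGroup.ker_mk']
    exact hM
  have h2 : N.map π ≤ Subgroup.centralizer (N.map π : Set (G ⧸ M)) := by
    have hx' : π x ∈ Subgroup.centralizer (N.map π : Set (G ⧸ M)) := by
      have : N.map π ≤ Subgroup.centralizer {π x} := by
        conv_lhs => rw [hN]
        rw [Subgroup.map_sup, MonoidHom.map_zpowers]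
        refine sup_le ?_ (h1.trans (Subgroup.centralizer_le ?_))
        · rw [Subgroup.zpowers_le, Subgroup.mem_centralizer_singleton_iff]
        · exact Set.singleton_subset_iff.2 (Subgroup.mem_map_of_mem π hx)
      rw [Subgroup.mem_centralizer_iff]
      intro y hy
      exact (Subgroup.mem_centralizer_singleton_iff.1 (this hy))
    conv_lhs => rw [hN]
    rw [Subgroup.map_sup, MonoidHom.map_zpowers]
    exact sup_le (by rwa [Subgroup.zpowers_le]) h1
  rwa [← Subgroup.commutator_eq_bot_iff_le_centralizer, ← Subgroup.map_commutator,
    Subgroup.map_eq_bot_iff, QuotientGroup.ker_mk'] at h2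

variable [Finite G] {p : ℕ}

theorem IsPGroup.exists_relIndex_eq (hp : p.Prime) (hG : IsPGroup p G) (K L : Subgroup G) :
    ∃ a, K.relIndex L = p ^ a := by
  have := Fact.mk hp
  obtain ⟨n, hn⟩ := IsPGroup.iff_card.1 (hG.to_subgroup L)
  obtain ⟨a, -, ha⟩ := (Nat.dvd_prime_pow hp).1 (hn ▸ Subgroup.relIndex_dvd_card K L)
  exact ⟨a, ha⟩

theorem IsPGroup.le_relIndex (hp : p.Prime) (hG : IsPGroup p G) {K L : Subgroup G}
    (h : ¬ L ≤ K) : p ≤ K.relIndex L := by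
  obtain ⟨a, ha⟩ := hG.exists_relIndex_eq hp K L
  rw [ha]
  refine Nat.le_self_pow (fun h0 => h ?_) p
  rw [h0, pow_zero] at ha
  exact Subgroup.relIndex_eq_one.1 ha

theorem relIndex_le_of_le {K K' L : Subgroup G} (h : K ≤ K') : K'.relIndex L ≤ K.relIndex L :=
  Nat.le_of_dvd (Nat.pos_of_ne_zero Subgroup.FiniteIndex.index_ne_zero)
    (Subgroup.relIndex_dvd_of_le_left L h)

/-- P. Hall's lower bound for the order of `N / [N, N]`. -/
theorem IsPGroup.pow_le_relIndex_commutator (hp : p.Prime) (hG : IsPGroup p G) {N : Subgroup G}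
    [N.Normal] {k : ℕ} (hk : 1 ≤ k) (hN : N ≤ lcs G k) (hne : ⁅N, N⁆ ≠ ⊥) :
    p ^ (k + 1) ≤ (⁅N, N⁆).relIndex N := by
  have := Fact.mk hp
  have := hG.isNilpotent
  have hle : ⁅N, N⁆ ≤ iteratedCommutator N k :=
    (Subgroup.commutator_mono le_rfl hN).trans (commutator_lcs_le N k)
  have hstrict : ∀ j ≤ k, ¬ iteratedCommutator N j ≤ iteratedCommutator N (j + 1) := fun j hj =>
    iteratedCommutator_not_le fun h =>
      hne (le_bot_iff.1 (hle.trans ((iteratedCommutator_antitone N hj).trans h.le)))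
  have hprod := relIndex_eq_prod (iteratedCommutator_antitone N) k
  have hsplit := Subgroup.relIndex_mul_relIndex ⁅N, N⁆ (iteratedCommutator N k)
    (iteratedCommutator N 0) hle (iteratedCommutator_antitone N (Nat.zero_le k))
  change _ = (⁅N, N⁆).relIndex N at hsplit
  rw [← hsplit, hprod]
  obtain ⟨a, ha⟩ := hG.exists_relIndex_eq hp (iteratedCommutator N 1) (iteratedCommutator N 0)
  have ha0 : a ≠ 0 := by
    rintro rfl
    exact hstrict 0 (Nat.zero_le k) (Subgroup.relIndex_eq_one.1 ha)
  -- The strict chain of k steps gives p^k. The extra factor p comes from the first step if its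
  -- index is at least p^2; if that index is p, [N, N] lies one step deeper and the chain is longer.
  rcases (show a = 1 ∨ 2 ≤ a by omega) with rfl | ha2
  · have hNN : ⁅N, N⁆ ≤ iteratedCommutator N (k + 1) := by
      refine commutator_le_of_relIndex_prime hp (iteratedCommutator_succ_le N 0)
        (ha.trans (pow_one p)) ?_
      rw [← iteratedCommutator_comm N k]
      exact (Subgroup.commutator_mono le_rfl hN).trans (commutator_lcs_le ⁅N, ⊤⁆ k)
    rw [pow_succ']
    refine Nat.mul_le_mul ?_ ?_
    · exact (hG.le_relIndex hp (hstrict k le_rfl)).trans (relIndex_le_of_le hNN)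
    · have := Finset.prod_le_prod' (s := Finset.range k) (f := fun _ => p) fun j hj =>
        hG.le_relIndex hp (hstrict j (Finset.mem_range.1 hj).le)
      simpa using this
  · obtain ⟨l, rfl⟩ := Nat.exists_eq_add_of_le' hk
    rw [Finset.prod_range_succ', zero_add, ha]
    calc p ^ (l + 1 + 1) = 1 * (p ^ l * p ^ 2) := by ring
      _ ≤ _ := by
        refine Nat.mul_le_mul (Nat.pos_of_ne_zero Subgroup.FiniteIndex.index_ne_zero)
          (Nat.mul_le_mul ?_ (Nat.pow_le_pow_right hp.pos ha2))
        have := Finset.prod_le_prod' (s := Finset.range l) (f := fun _ => p) fun j hj =>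
          hG.le_relIndex hp (hstrict (j + 1) (by have := Finset.mem_range.1 hj; omega))
        simpa using this

theorem IsPGroup.pow_three_le_relIndex_lcs (hp : p.Prime) (hG : IsPGroup p G) {H : Subgroup G}
    {k : ℕ} (hk : 1 ≤ k) (hH : H ≤ lcs G k)
    (h : ¬ ⁅⁅H, H⁆, ⁅H, H⁆⁆ ≤ lcs G (4 * k + 1)) :
    p ^ 3 ≤ (lcs G (k + 1)).relIndex H := by
  obtain ⟨a, ha⟩ := hG.exists_relIndex_eq hp (lcs G (k + 1)) H
  rw [ha]
  refine Nat.pow_le_pow_right hp.pos ?_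
  by_contra! hlt
  obtain ⟨z, hz, hle⟩ := commutator_le_zpowers_sup_of_relIndex_dvd hp hk hH
    (ha ▸ pow_dvd_pow p (by omega : a ≤ 2))
  exact h ((commutator_self_le_of_le_zpowers_sup (by omega) hz hle).trans
    (lcs_antitone (by omega)))

theorem IsPGroup.pow_le_relIndex_commutator_of_not_le (hp : p.Prime) (hp5 : 5 ≤ p)
    (hG : IsPGroup p G) {J : Subgroup G} [J.Normal] {m : ℕ} (hm : 1 ≤ m) (hJ : J ≤ lcs G m)
    (h : ¬ ⁅⁅⁅J, J⁆, ⁅J, J⁆⁆, ⁅⁅J, J⁆, ⁅J, J⁆⁆⁆ ≤ lcs G (8 * m + 1)) :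
    p ^ (2 * m + 3) ≤ (⁅⁅J, J⁆, ⁅J, J⁆⁆).relIndex ⁅J, J⁆ := by
  set H := ⁅J, J⁆ with hHdef
  have hH : H ≤ lcs G (2 * m) :=
    (Subgroup.commutator_mono hJ hJ).trans (commutator_lcs_lcs_le.trans (lcs_antitone (by omega)))
  have hHH : ⁅H, H⁆ ≤ lcs G (4 * m) :=
    (Subgroup.commutator_mono hH hH).trans (commutator_lcs_lcs_le.trans (lcs_antitone (by omega)))
  let f : ℕ → Subgroup G := fun j => H ⊓ lcs G (2 * m + j)
  have hf : Antitone f := fun i j hij => inf_le_inf_left H (lcs_antitone (by omega))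
  have hf0 : f 0 = H := inf_eq_left.2 hH
  have hHf : ⁅H, H⁆ ≤ f (2 * m) :=
    le_inf (Subgroup.commutator_le_left _ _) (hHH.trans (lcs_antitone (by omega)))
  -- A repeated term would shift all later [H, G, …, G] one degree deeper, forcing [H, H] ≤
  -- γ_{4m+1}.
  have hstrict : ∀ j < 2 * m, ¬ f j ≤ f (j + 1) := by
    intro j hj hle
    have h1 : iteratedCommutator H j ≤ lcs G (2 * m + (j + 1)) := by
      refine (le_inf (iteratedCommutator_antitone H (Nat.zero_le j)) ?_).trans (hle.trans inf_le_right)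
      exact (iteratedCommutator_mono hH j).trans (iteratedCommutator_lcs (by omega) j).le
    have h2 : iteratedCommutator H (2 * m) ≤ lcs G (4 * m + 1) := by
      have := iteratedCommutator_mono h1 (2 * m - j)
      rw [← iteratedCommutator_add, iteratedCommutator_lcs (by omega)] at this
      rw [show 2 * m = j + (2 * m - j) by omega]
      exact this.trans (lcs_antitone (by omega))
    have h3 : ⁅H, H⁆ ≤ lcs G (4 * m + 1) :=
      ((Subgroup.commutator_mono le_rfl hH).trans (commutator_lcs_le H _)).trans h2
    exact h ((Subgroup.commutator_mono h3 h3).trans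
      (commutator_lcs_lcs_le.trans (lcs_antitone (by omega))))
  -- One for each of the 2m factors, two more in degree 2m (j = 0), one more in degree 3m (j = m):
  -- 2m + 3 in total.
  have hfac : ∀ j ∈ Finset.range (2 * m), p ^ (1 + (if j = 0 then 2 else 0) + if j = m then 1 else 0) ≤
      (f (j + 1)).relIndex (f j) := by
    intro j hj
    rcases Nat.eq_zero_or_pos j with rfl | hj0
    · rw [if_pos rfl, if_neg (by omega : 0 ≠ m), hf0]
      have := hG.pow_three_le_relIndex_lcs hp (by omega) hH
        (fun hle => h (hle.trans (lcs_antitone (by omega))))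
      exact this.trans (relIndex_le_of_le inf_le_right)
    · rw [if_neg hj0.ne']
      obtain ⟨a, ha⟩ := hG.exists_relIndex_eq hp (f (j + 1)) (f j)
      have ha0 : a ≠ 0 := by
        rintro rfl
        exact hstrict j (Finset.mem_range.1 hj) (Subgroup.relIndex_eq_one.1 ha)
      rw [ha]
      refine Nat.pow_le_pow_right hp.pos ?_
      split_ifs with hjm
      · subst hjm
        by_contra! hlt
        obtain rfl : a = 1 := by omega
        have hi : (lcs G (3 * j + 1)).relIndex (H ⊓ lcs G (3 * j)) = p := by
          rw [pow_one] at ha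
          have e1 : f j = H ⊓ lcs G (3 * j) := by
            change H ⊓ lcs G (2 * j + j) = _
            congr 2; omega
          have e2 : f (j + 1) = lcs G (3 * j + 1) ⊓ (H ⊓ lcs G (3 * j)) := by
            change H ⊓ lcs G (2 * j + (j + 1)) = _
            rw [show 2 * j + (j + 1) = 3 * j + 1 by omega, inf_left_comm,
              inf_eq_left.2 (lcs_antitone (Nat.le_succ (3 * j)))]
          rwa [e1, e2, Subgroup.inf_relIndex_right] at ha
        obtain ⟨z, hz, hle⟩ := commutator_commutator_le_zpowers_sup hp hp5 hm hJ hi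
        exact h ((commutator_self_le_of_le_zpowers_sup (by omega) hz hle).trans
          (lcs_antitone (by omega)))
      · omega
  calc p ^ (2 * m + 3)
      = ∏ j ∈ Finset.range (2 * m), p ^ (1 + (if j = 0 then 2 else 0) + if j = m then 1 else 0) := by
        rw [Finset.prod_pow_eq_pow_sum, Finset.sum_add_distrib, Finset.sum_add_distrib]
        simp only [Finset.sum_ite_eq', Finset.mem_range]
        rw [if_pos (by omega), if_pos (by omega)]
        simp
    _ ≤ ∏ j ∈ Finset.range (2 * m), (f (j + 1)).relIndex (f j) := Finset.prod_le_prod' hfac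
    _ = (f (2 * m)).relIndex H := by rw [← relIndex_eq_prod hf, hf0]
    _ ≤ _ := relIndex_le_of_le hHf

end Index

/-! ### Summation along the derived series -/

section DerivedLength

/-- A lower bound for the excess of `log_p |G^(i) / G^(i+1)|` over P. Hall's bound `2 ^ i + 1` when
`j` is the first index for which `G^(j)` lies deeper than degree `2 ^ j` in the lower central
series. -/
def derivedExcess (j i : ℕ) : ℕ :=
  if i + 2 < j then (if i = 0 then 1 else 2) else if i < j then 0 else 2 ^ (i - j)

/-- With d = j + t, the excess is at least 2j - 5 below j and equals 2^t - 1 ≥ 2t - 1 from j on, so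
it totals at least 2d - 6. The separate `+ 1` accounts for G^(d) ≠ 1. -/
theorem le_sum_derivedExcess (j t : ℕ) :
    2 ^ (j + t) + 3 * (j + t) ≤
      (∑ i ∈ Finset.range (j + t), (2 ^ i + 1 + derivedExcess j i)) + 1 + 6 := by
  have h1 : ∀ n, (∑ i ∈ Finset.range n, 2 ^ i) + 1 = 2 ^ n := fun n => by
    induction n with
    | zero => rfl
    | succ n ih => rw [Finset.sum_range_succ, pow_succ]; omega
  have h2 : ∑ s ∈ Finset.range t, derivedExcess j (j + s) = ∑ s ∈ Finset.range t, 2 ^ s :=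
    Finset.sum_congr rfl fun s _ => by
      rw [derivedExcess, if_neg (by omega), if_neg (by omega), Nat.add_sub_cancel_left]
  have h3 : 2 * j ≤ (∑ i ∈ Finset.range j, derivedExcess j i) + 5 := by
    rcases (show j < 3 ∨ 3 ≤ j by omega) with hj | hj
    · omega
    · obtain ⟨n, rfl⟩ := Nat.exists_eq_add_of_le' hj
      have h4 : ∑ i ∈ Finset.range n, derivedExcess (n + 3) (i + 1) = n * 2 := by
        rw [Finset.sum_congr rfl (g := fun _ => 2) fun i hi => by
          rw [derivedExcess, if_pos (by have := Finset.mem_range.1 hi; omega),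
            if_neg (Nat.succ_ne_zero i)], Finset.sum_const, Finset.card_range, smul_eq_mul]
      have h5 : derivedExcess (n + 3) 0 = 1 := by
        rw [derivedExcess, if_pos (by omega), if_pos rfl]
      rw [Finset.sum_range_succ, Finset.sum_range_succ, Finset.sum_range_succ', h4, h5]
      omega
  have h4 : 2 * t ≤ 2 ^ t := by
    induction t with
    | zero => simp
    | succ t ih =>
      have := Nat.one_le_two_pow (n := t)
      have := Nat.lt_two_pow_self (n := t)
      rw [pow_succ]; omega
  rw [Finset.sum_add_distrib, Finset.sum_add_distrib, Finset.sum_range_add (derivedExcess j), h2,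
    Finset.sum_const, Finset.card_range, smul_eq_mul, mul_one]
  have := h1 (j + t)
  have := h1 t
  omega

variable {G : Type*} [Group G] [Finite G] {p : ℕ}

theorem IsPGroup.pow_le_relIndex_derivedSeries (hp : p.Prime) (hp5 : 5 ≤ p) (hG : IsPGroup p G)
    {i j : ℕ} (hi : derivedSeries G (i + 1) ≠ ⊥)
    (hj : i + 2 < j → ¬ derivedSeries G (i + 2) ≤ lcs G (2 ^ (i + 2) + 1))
    (hj' : j ≤ i → derivedSeries G j ≤ lcs G (2 ^ j + 1)) :
    p ^ (2 ^ i + 1 + derivedExcess j i) ≤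
      (derivedSeries G (i + 1)).relIndex (derivedSeries G i) := by
  have hall : ∀ k, 1 ≤ k → derivedSeries G i ≤ lcs G k →
      p ^ (k + 1) ≤ (derivedSeries G (i + 1)).relIndex (derivedSeries G i) := fun k hk hle => by
    have := derivedSeries_normal G i
    exact hG.pow_le_relIndex_commutator hp hk hle hi
  unfold derivedExcess
  split_ifs with h1 h2 h3
  · subst h2
    have h4 : ¬ ⁅⁅(⊤ : Subgroup G), ⊤⁆, ⁅(⊤ : Subgroup G), ⊤⁆⁆ ≤ lcs G (4 * 1 + 1) := hj h1
    have h5 : p ^ 3 ≤ (lcs G (1 + 1)).relIndex ⊤ :=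
      hG.pow_three_le_relIndex_lcs hp le_rfl le_top h4
    rw [lcs_succ le_rfl, lcs_one] at h5
    exact h5
  · obtain ⟨l, rfl⟩ := Nat.exists_eq_succ_of_ne_zero h2
    have := derivedSeries_normal G l
    have h4 := hG.pow_le_relIndex_commutator_of_not_le hp hp5 (m := 2 ^ l) Nat.one_le_two_pow
      (derivedSeries_le_lcs l) (fun hle => hj h1 (hle.trans (lcs_antitone (by
        rw [show l.succ + 2 = l + 3 from rfl, pow_add]; omega))))
    rw [show 2 ^ l.succ + 1 + 2 = 2 * 2 ^ l + 3 by rw [Nat.succ_eq_add_one, pow_succ']]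
    exact h4
  · exact hall _ Nat.one_le_two_pow (derivedSeries_le_lcs i)
  · obtain ⟨s, rfl⟩ := Nat.exists_eq_add_of_le (not_lt.1 h3)
    -- This depth is 2^(j+s) + 2^s, so Hall's bound supplies exactly the excess 2^s.
    have h4 := hall (2 ^ s * (2 ^ j + 1)) (Nat.mul_pos (by positivity) (by positivity))
      (derivedSeries_le_lcs_add (hj' (Nat.le_add_right j s)) s)
    rw [Nat.add_sub_cancel_left]
    convert h4 using 2
    ring

theorem IsPGroup.pow_le_card_of_derivedSeries_ne_bot (hp : p.Prime) (hp5 : 5 ≤ p)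
    (hG : IsPGroup p G) {d : ℕ} (hd : derivedSeries G d ≠ ⊥) :
    ∃ n, 2 ^ d + 3 * d ≤ n + 6 ∧ p ^ n ≤ Nat.card G := by
  obtain ⟨j, hjd, hj, hj'⟩ : ∃ j ≤ d, (∀ i < j, ¬ derivedSeries G i ≤ lcs G (2 ^ i + 1)) ∧
      (j < d → derivedSeries G j ≤ lcs G (2 ^ j + 1)) := by
    classical
    -- Allowing j = d guarantees existence; the inclusion is then needed only when j < d.
    have hex : ∃ j, j = d ∨ derivedSeries G j ≤ lcs G (2 ^ j + 1) := ⟨d, .inl rfl⟩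
    exact ⟨Nat.find hex, Nat.find_min' hex (.inl rfl),
      fun i hi hle => Nat.find_min hex hi (.inr hle),
      fun hlt => (Nat.find_spec hex).resolve_left hlt.ne⟩
  obtain ⟨t, rfl⟩ := Nat.exists_eq_add_of_le hjd
  refine ⟨_, le_sum_derivedExcess j t, ?_⟩
  have hfac : ∀ i ∈ Finset.range (j + t), p ^ (2 ^ i + 1 + derivedExcess j i) ≤
      (derivedSeries G (i + 1)).relIndex (derivedSeries G i) := fun i hi => by
    have hi := Finset.mem_range.1 hi
    refine hG.pow_le_relIndex_derivedSeries hp hp5 (fun h => hd ?_) (fun h => hj _ h)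
      fun h => hj' (by omega)
    exact le_bot_iff.1 (h ▸ derivedSeries_antitone G hi)
  have hlast : p ≤ (⊥ : Subgroup G).relIndex (derivedSeries G (j + t)) :=
    hG.le_relIndex hp fun h => hd (le_bot_iff.1 h)
  have hcard : Nat.card G = (⊥ : Subgroup G).relIndex (derivedSeries G 0) := by
    rw [derivedSeries_zero, Subgroup.relIndex_top_right, Subgroup.index_bot]
  rw [hcard, ← Subgroup.relIndex_mul_relIndex ⊥ (derivedSeries G (j + t)) _ bot_le
    (derivedSeries_antitone G (Nat.zero_le _)), relIndex_eq_prod (derivedSeries_antitone G),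
    pow_succ', ← Finset.prod_pow_eq_pow_sum]
  exact Nat.mul_le_mul hlast (Finset.prod_le_prod' hfac)

end DerivedLength

theorem theorem1p1 {p : ℕ} (hp : p.Prime) (hp5 : 5 ≤ p) {G : Type*} [Group G] [Finite G]
    (hG : IsPGroup p G) (d : ℕ) (hd : derivedSeries G d ≠ ⊥) :
    (2 : ℝ) ^ d + 3 * (d : ℝ) - 6 ≤ Real.logb (p : ℝ) (Nat.card G : ℝ) := by
  obtain ⟨n, hn, hcard⟩ := hG.pow_le_card_of_derivedSeries_ne_bot hp hp5 hd
  have h1 : (2 : ℝ) ^ d + 3 * (d : ℝ) ≤ n + 6 := by exact_mod_cast hn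
  have h2 : (n : ℝ) ≤ Real.logb (p : ℝ) (Nat.card G : ℝ) := by
    rw [Real.le_logb_iff_rpow_le (by exact_mod_cast hp.one_lt) (by exact_mod_cast Nat.card_pos),
      Real.rpow_natCast]
    exact_mod_cast hcard
  linarith
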